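/- **Setting.** For $m\ge 1$ let $V_m$ consist of the $m^2$ pixels of an $m\times m$ image, a source $s$ and a sink $t$, and let $n=|V_m|=m^2+2$. A network on $V_m$ is a loopless directed graph on $V_m$ with nonnegative real edge capacities. An $m\times m$ grid network is a network in which horizontally or vertically neighbouring pixels are joined in both directions, $s$ is joined to the pixels of an arbitrary set, the pixels of another arbitrary set are joined to $t$, and there are no further edges. For a family $X$ of networks on $V_m$ let $E_{\max}(X)$ be the set of all edges that occur in some member of $X$, and let $E_m=E_{\max}(\text{all networks on }V_m)$. Given $d\ge 1$, a measurable feature map $\phi\colon X\times (V_m\times V_m)\to\mathbb R^d$ and a fixed rule for breaking ties, edge selection on $X$ is the hypothesis class $$H_X=\Bigl\{h_w\colon G\mapsto \arg\max_{e\in E(G)} w\cdot\phi(G,e)\ \Bigm|\ w\in\mathbb R^d\Bigr\}.$$ $H_X$ is *PAC learnable from $r(\varepsilon,\delta)$ examples* (in the realizable case) if there is one algorithm, mapping finite labelled samples to members of $H_X$, such that for all $\varepsilon,\delta\in(0,1)$, all integers $M\ge r(\varepsilon,\delta)$, every probability distribution $D$ on $X$ and every labelling $f$ that agrees $D$-almost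 surely with some member of $H_X$, the output $h$ on $M$ independent examples drawn from $D$ and labelled by $f$ satisfies $D(h\ne f)\le\varepsilon$ with probability at least $1-\delta$. The sample complexity of $H_X$ at $(\varepsilon,\delta)$ is the least $M_0$ for which some algorithm achieves this for all $M\ge M_0$ (at the given $\varepsilon,\delta$). Put $$B(K,d,\varepsilon,\delta)=\frac{K d\,\log^2\!\left(\frac{K d}{\varepsilon}\right)+\log\frac1\delta}{\varepsilon},\qquad B(0,d,\varepsilon,\delta)=\frac{\log\frac1\delta}{\varepsilon}.$$ **Theorem.** 1. (Edge counts) For every $m\ge1$ and every family $X$ of $m\times m$ grid networks, $|E_{\max}(X)|\le 6n$, whereas $|E_m|=n(n-1)$. 2. (Sufficient sample sizes) There is an absolute constant $C>0$ such that for all $m,d\ge1$, all feature maps and all tie-breaking rules: (a) for every family $X$ of networks on $V_m$ (in particular, for the family of all of them, where $|E_{\max}(X)|=|E_m|$), $H_X$ is PAC learnable from $C\,B(|E_{\max}(X)|,d,\varepsilon,\delta)$ examples; (b) for every family $X$ of $m\times m$ grid networks, $H_X$ is PAC learnable from $C\,B(\sqrt{|E_m|},d,\varepsilon,\delta)$ examples.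 3. (Grids need fewer examples, as measured by these bounds) For all $m,d\ge1$, $\varepsilon,\delta\in(0,1)$ and every family $X$ of $m\times m$ grid networks, $$B(|E_{\max}(X)|,d,\varepsilon,\delta)<B(|E_m|,d,\varepsilon,\delta)\quad\text{and}\quad B(\sqrt{|E_m|},d,\varepsilon,\delta)<B(|E_m|,d,\varepsilon,\delta).$$ Moreover, for fixed $d,\varepsilon,\delta$ and families $X_m$ of $m\times m$ grid networks, both ratios $$\frac{B(|E_{\max}(X_m)|,d,\varepsilon,\delta)}{B(|E_m|,d,\varepsilon,\delta)},\qquad \frac{B(\sqrt{|E_m|},d,\varepsilon,\delta)}{B(|E_m|,d,\varepsilon,\delta)}$$ tend to $0$ as $m\to\infty$. 4. (Sample complexities) For every family $X$ of $m\times m$ grid networks ($m\ge 1$), every feature map on all networks on $V_m$ and all $\varepsilon,\delta\in(0,1)$, the sample complexity of edge selection on $X$ (with the restricted feature map) is at most that of edge selection on the family of all networks on $V_m$. -/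

import Mathlib

open MeasureTheory Filter Topology

noncomputable section

namespace EdgePAC

/-- A flow network on the vertex set `V`: a loopless directed graph together with a nonnegative
real capacity for each of its edges (extended by zero to the pairs that are not edges). -/
@[ext]
structure Network (V : Type) where
  edges : Finset (V × V)
  loopless : ∀ e ∈ edges, e.1 ≠ e.2
  cap : V × V → ℝ
  cap_nonneg : ∀ e, 0 ≤ cap e
  cap_eq_zero : ∀ e, e ∉ edges → cap e = 0

/-- The sigma-algebra generated by the (discrete) edge set and the (real) capacities. -/
instance (V : Type) : MeasurableSpace (Network V) :=
  MeasurableSpace.comap (fun N : Network V => N.edges) ⊤ ⊔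
    MeasurableSpace.comap (fun N : Network V => N.cap) MeasurableSpace.pi

open Classical in
/-- `E_max`: the set of all edges that occur in some member of the family `X`. -/
def edgeMax {V : Type} [Fintype V] (X : Set (Network V)) : Finset (V × V) :=
  Finset.univ.filter fun e => ∃ N ∈ X, e ∈ N.edges

open Classical in
/-- The set of edges of `G` that maximize the linear score `w ⬝ᵥ φ(G, e)`. -/
def argmaxEdges {V : Type} {X : Set (Network V)} {d : ℕ}
    (φ : X → V × V → Fin d → ℝ) (w : Fin d → ℝ) (G : X) : Finset (V × V) :=
  G.1.edges.filter fun e => ∀ e' ∈ G.1.edges, w ⬝ᵥ φ G e' ≤ w ⬝ᵥ φ G e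

/-- A rule that breaks ties: it picks an element of every nonempty set of edges. -/
def IsTieBreak {V : Type} (tie : Finset (V × V) → V × V) : Prop :=
  ∀ s : Finset (V × V), s.Nonempty → tie s ∈ s

/-- The hypothesis `h_w : G ↦ argmax_{e ∈ E(G)} w ⬝ᵥ φ(G, e)`, ties being broken by `tie`.
On a graph without edges all hypotheses return the same value `tie ∅`. -/
def edgeSelector {V : Type} {X : Set (Network V)} {d : ℕ}
    (tie : Finset (V × V) → V × V) (φ : X → V × V → Fin d → ℝ) (w : Fin d → ℝ) (G : X) : V × V :=
  tie (argmaxEdges φ w G)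

/-- A (proper) learning algorithm for a class of hypotheses indexed by `W`: it maps each finite
labelled sample to (the index of) a hypothesis. -/
abbrev Learner (α β W : Type) : Type := ∀ M : ℕ, (Fin M → α × β) → W

/-- With `M` examples the learner `A` is probably approximately correct in the realizable case:
for every distribution `D` on instances and every labelling `f` that agrees almost surely with
some hypothesis of the class, the hypothesis returned on `M` independent labelled examples has
error at most `ε`, except on an event of (outer) probability at most `δ`. -/
def LearnsWith {α β W : Type} [MeasurableSpace α] (h : W → α → β) (A : Learner α β W)
    (ε δ : ℝ) (M : ℕ) : Prop :=
  ∀ D : Measure α, IsProbabilityMeasure D → ∀ f : α → β, (∃ w, ∀ᵐ x ∂D, h w x = f x) →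
    (Measure.pi fun _ : Fin M => D)
      {S | ENNReal.ofReal ε < D {x | h (A M fun i => (S i, f (S i))) x ≠ f x}} ≤ ENNReal.ofReal δ

/-- The class `h` is PAC learnable, by one algorithm that knows neither `ε`, `δ` nor the
distribution, from any number `M ≥ r ε δ` of examples. -/
def PACLearnableWith {α β W : Type} [MeasurableSpace α] (h : W → α → β) (r : ℝ → ℝ → ℝ) : Prop :=
  ∃ A : Learner α β W, ∀ ε δ : ℝ, 0 < ε → ε < 1 → 0 < δ → δ < 1 →
    ∀ M : ℕ, r ε δ ≤ M → LearnsWith h A ε δ M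

/-- The sample complexity: the least `M₀` such that some algorithm succeeds from any number
`M ≥ M₀` of examples (`⊤` if there is none). -/
def sampleComplexity {α β W : Type} [MeasurableSpace α] (h : W → α → β) (ε δ : ℝ) : ℕ∞ :=
  ⨅ (M₀ : ℕ) (_ : ∃ A : Learner α β W, ∀ M, M₀ ≤ M → LearnsWith h A ε δ M), (M₀ : ℕ∞)

/-- The expression `(K d log²(K d / ε) + log(1 / δ)) / ε`. -/
def sampleBound (K : ℝ) (d : ℕ) (ε δ : ℝ) : ℝ :=
  (K * d * Real.log (K * d / ε) ^ 2 + Real.log (1 / δ)) / ε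

/-- The pixels of an `m × m` image. -/
abbrev Pixel (m : ℕ) : Type := Fin m × Fin m

/-- The vertices of an image segmentation graph: the pixels and the two terminals. -/
abbrev GridVertex (m : ℕ) : Type := Pixel m ⊕ Bool

/-- The source terminal. -/
def source (m : ℕ) : GridVertex m := Sum.inr false

/-- The sink terminal. -/
def sink (m : ℕ) : GridVertex m := Sum.inr true

/-- Two pixels are neighbours if they differ by one step in exactly one coordinate. -/
def PixelAdj {m : ℕ} (p q : Pixel m) : Prop :=
  (p.1 = q.1 ∧ (p.2.val + 1 = q.2.val ∨ q.2.val + 1 = p.2.val)) ∨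
    (p.2 = q.2 ∧ (p.1.val + 1 = q.1.val ∨ q.1.val + 1 = p.1.val))

/-- The edges of the `m × m` grid graph in which the source is joined to the pixels in `S` and the
pixels in `T` are joined to the sink; neighbouring pixels are joined in both directions. -/
def IsGridEdge {m : ℕ} (S T : Finset (Pixel m)) (e : GridVertex m × GridVertex m) : Prop :=
  (∃ p q, PixelAdj p q ∧ e = (Sum.inl p, Sum.inl q)) ∨
    (∃ p ∈ S, e = (source m, Sum.inl p)) ∨ (∃ p ∈ T, e = (Sum.inl p, sink m))

/-- All `m × m` grid networks, with arbitrary capacities and arbitrary sets of pixels attached to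
the source and to the sink. -/
def gridNetworks (m : ℕ) : Set (Network (GridVertex m)) :=
  {N | ∃ S T : Finset (Pixel m), ∀ e, e ∈ N.edges ↔ IsGridEdge S T e}

/-- The number of potential edges of the collection of all networks on the `m ^ 2 + 2` vertices of
an `m × m` segmentation graph. -/
def allEdges (m : ℕ) : ℕ := (edgeMax (Set.univ : Set (Network (GridVertex m)))).card

end EdgePAC

end

namespace EdgePAC

/-! The selected edge depends on `w` only through the signs of `w ⬝ᵥ (φ G e' - φ G e)` for pairs of
edges in `edgeMax X`. On `L` instances a hypothesis is therefore determined by which of `L *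
|edgeMax X| ^ 2` vectors lie in an open half-space through the origin. Such half-spaces have VC
dimension at most `d` (`vcDim_range_positivePart_le`), so by Sauer–Shelah at most `(L * |edgeMax X|
^ 2 + 1) ^ d` behaviours occur.

Symmetrization with a second sample (`measure_exists_consistent_bad_le`) turns this polynomial
growth into a failure probability of at most `2 * (2 * M * |edgeMax X| ^ 2 + 1) ^ d * 2 ^ (-(ε * M /
2))` for any learner that returns a consistent hypothesis. `growth_mul_rpow_le` shows that the
stated sample size makes this at most `δ`.

For grids, `|edgeMax X| ≤ 6 * n ≤ 9 * √(allEdges m)`, so the square root can replace the edge count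
at the price of a constant. The comparisons of bounds rest on linear against quadratic edge counts.
The inequality of sample complexities is independent of all this: a learner for the larger family
also serves the smaller one, through the pushforward of the distribution. -/

/-! ### Symmetrization with a ghost sample -/

/-- If an event has probability more than `ε`, then among `M ≥ 6 / ε` independent trials it occurs
at least `ε M / 2` times with probability at least `1 / 2`. -/
theorem half_le_measure_card_mem {α : Type} [MeasurableSpace α] (D : Measure α)
    [IsProbabilityMeasure D] {s : Set α} (hs : MeasurableSet s) [DecidablePred (· ∈ s)] {ε : ℝ}
    (hε : 0 < ε) (hD : ENNReal.ofReal ε < D s) {M : ℕ} (hM : 6 ≤ ε * M) :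
    ENNReal.ofReal (1 / 2) ≤ Measure.pi (fun _ : Fin M => D)
      {T | ε * M / 2 ≤ ((Finset.univ.filter fun i => T i ∈ s).card : ℝ)} := by
  set μ := Measure.pi (fun _ : Fin M => D)
  -- Chernoff's method with base `1 / 2`: the product of `g` over the trials is `2 ^ (-count)`, and
  -- Markov's inequality for it bounds the probability of a small count.
  let g : α → ℝ := fun x => if x ∈ s then 1 / 2 else 1
  have hg : ∀ x, g x = 1 - s.indicator (fun _ => (1 / 2 : ℝ)) x := by
    intro x
    by_cases hx : x ∈ s <;> simp [g, hx]; norm_num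
  have hgm : Measurable g := Measurable.ite hs measurable_const measurable_const
  have hg0 : ∀ x, 0 ≤ g x := by intro x; dsimp only [g]; split_ifs <;> norm_num
  have hg1 : ∀ x, g x ≤ 1 := by intro x; dsimp only [g]; split_ifs <;> norm_num
  have hp : ε < D.real s := by
    rw [Measure.real, ← ENNReal.ofReal_lt_iff_lt_toReal hε.le (measure_ne_top _ _)]
    exact hD
  have hgint : ∫ x, g x ∂D = 1 - D.real s / 2 := by
    simp_rw [hg]
    rw [integral_sub (integrable_const _) ((integrable_const _).indicator hs),
      integral_indicator_const _ hs]
    simp; ring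
  have hGm : Measurable fun T : Fin M → α => ∏ i, g (T i) := by fun_prop
  have hG0 : ∀ T : Fin M → α, 0 ≤ ∏ i, g (T i) := fun T => Finset.prod_nonneg fun i _ => hg0 _
  have hG1 : ∀ T : Fin M → α, ∏ i, g (T i) ≤ 1 := fun T =>
    Finset.prod_le_one (fun i _ => hg0 _) fun i _ => hg1 _
  have hGi : Integrable (fun T : Fin M → α => ∏ i, g (T i)) μ := by
    refine Integrable.of_bound hGm.aestronglyMeasurable 1 (ae_of_all _ fun T => ?_)
    rw [Real.norm_of_nonneg (hG0 T)]
    exact hG1 T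
  have hGint : ∫ T, ∏ i, g (T i) ∂μ = (1 - D.real s / 2) ^ M := by
    rw [integral_fintype_prod_eq_pow, hgint, Fintype.card_fin]
  have hGcard : ∀ T : Fin M → α,
      ∏ i, g (T i) = (1 / 2 : ℝ) ^ (Finset.univ.filter fun i => T i ∈ s).card := by
    intro T
    simp [g, Finset.prod_ite]
  set B := {T : Fin M → α | ε * M / 2 ≤ ((Finset.univ.filter fun i => T i ∈ s).card : ℝ)} with hB
  have hcm : Measurable fun T : Fin M → α =>
      ((Finset.univ.filter fun i => T i ∈ s).card : ℝ) := by
    have : (fun T : Fin M → α => ((Finset.univ.filter fun i => T i ∈ s).card : ℝ)) =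
        fun T => ∑ i, if T i ∈ s then (1 : ℝ) else 0 := by
      ext T; simp
    rw [this]
    refine Finset.measurable_sum _ fun i _ => ?_
    exact Measurable.ite (measurable_pi_apply i hs) measurable_const measurable_const
  have hBm : MeasurableSet B := measurableSet_le measurable_const hcm
  have hsub : Bᶜ ⊆ {T | Real.exp (-(Real.log 2 * (ε * M / 2))) ≤ ∏ i, g (T i)} := by
    intro T hT
    simp only [hB, Set.mem_compl_iff, Set.mem_ofPred_eq, not_le] at hT ⊢
    rw [hGcard, one_div, inv_pow, ← Real.rpow_natCast, ← Real.rpow_neg (by norm_num),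
      Real.rpow_def_of_pos (by norm_num), mul_neg]
    gcongr
  have hmarkov := mul_meas_ge_le_integral_of_nonneg (ae_of_all μ hG0) hGi
    (Real.exp (-(Real.log 2 * (ε * M / 2))))
  have hcomp : μ.real Bᶜ ≤ 1 / 2 := by
    have h1 : Real.exp (-(Real.log 2 * (ε * M / 2))) * μ.real Bᶜ ≤ (1 - D.real s / 2) ^ M := by
      rw [← hGint]
      refine le_trans ?_ hmarkov
      exact mul_le_mul_of_nonneg_left (measureReal_mono hsub (measure_ne_top μ _))
        (Real.exp_pos _).le
    have h2 : (1 - D.real s / 2) ^ M ≤ Real.exp (-(ε * M / 2)) := by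
      have h3 : 1 - D.real s / 2 ≤ Real.exp (-(ε / 2)) := by
        have := Real.add_one_le_exp (-(ε / 2))
        linarith
      have h4 : 0 ≤ 1 - D.real s / 2 := by
        have : D.real s ≤ 1 := measureReal_le_one
        linarith
      calc (1 - D.real s / 2) ^ M ≤ Real.exp (-(ε / 2)) ^ M := pow_le_pow_left₀ h4 h3 M
        _ = _ := by rw [← Real.exp_nat_mul]; congr 1; ring
    have h5 : μ.real Bᶜ ≤ Real.exp (-(ε * M / 2) + Real.log 2 * (ε * M / 2)) := by
      rw [Real.exp_add, ← div_le_iff₀ (Real.exp_pos _), div_eq_mul_inv, ← Real.exp_neg, mul_comm]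
      exact h1.trans h2
    have h6 := Real.log_two_lt_d9
    refine h5.trans ?_
    have h8 : (1 / 2 : ℝ) = Real.exp (-Real.log 2) := by
      rw [Real.exp_neg, Real.exp_log (by norm_num), one_div]
    rw [h8]
    -- The hypothesis `6 ≤ ε * M` enters here: `(1 - log 2) * (ε * M / 2) ≥ 3 * (1 - log 2) > log
    -- 2`.
    apply Real.exp_le_exp.2
    nlinarith
  have h7 : μ.real B = 1 - μ.real Bᶜ := by
    rw [probReal_compl_eq_one_sub hBm]; ring
  rw [← ENNReal.ofReal_toReal (measure_ne_top μ B)]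
  apply ENNReal.ofReal_le_ofReal
  change _ ≤ μ.real B
  linarith

/-- Exchange the two entries of those pairs whose index is selected by `σ`. -/
def swapPairs {ι α : Type} (σ : ι → Bool) (z : ι → α × α) (i : ι) : α × α :=
  if σ i then (z i).swap else z i

theorem measurePreserving_swapPairs {ι α : Type} [Fintype ι] [MeasurableSpace α] (D : Measure α)
    [IsProbabilityMeasure D] (σ : ι → Bool) :
    MeasurePreserving (swapPairs (α := α) σ) (Measure.pi fun _ : ι => D.prod D)
      (Measure.pi fun _ : ι => D.prod D) := by
  refine measurePreserving_pi (f := fun i (p : α × α) => if σ i then p.swap else p) _ _ fun i => ?_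
  cases σ i
  · simpa [Function.id_def] using MeasurePreserving.id (D.prod D)
  · simpa using Measure.measurePreserving_swap

/-- List the entries of a family of pairs. -/
def unpair {ι α : Type} (z : ι → α × α) (j : ι × Bool) : α :=
  if j.2 then (z j.1).2 else (z j.1).1

theorem measurable_unpair {ι α : Type} [MeasurableSpace α] :
    Measurable (unpair (ι := ι) (α := α)) := by
  refine measurable_pi_lambda _ fun j => ?_
  obtain ⟨i, b⟩ := j
  cases b
  · simpa [unpair] using (measurable_pi_apply i).fst
  · simpa [unpair] using (measurable_pi_apply i).snd

open Classical in
/-- The pairs of samples for which some hypothesis agrees with `w₀` on the first sample and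
disagrees with it at least `k` times on the second one. -/
def ghostEvent {α β W : Type} (h : W → α → β) (w₀ : W) (ι : Type) [Fintype ι] (k : ℝ) :
    Set (ι → α × α) :=
  {z | ∃ w, (∀ i, h w (z i).1 = h w₀ (z i).1) ∧
    k ≤ ((Finset.univ.filter fun i => h w (z i).2 ≠ h w₀ (z i).2).card : ℝ)}

/-- The event is a union over a possibly uncountable parameter set. Sorting by the label pattern `y`
on the double sample makes the union finite and leaves only `hproj` to be known about the
parameters. -/
theorem measurableSet_ghostEvent {α β W ι : Type} [Fintype ι] [MeasurableSpace α]
    [MeasurableSpace β] [DiscreteMeasurableSpace β] [Finite β] (h : W → α → β)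
    (hh : ∀ w, Measurable (h w))
    (hproj : ∀ y : ι × Bool → β, MeasurableSet {x : ι × Bool → α | ∃ w, ∀ j, h w (x j) = y j})
    (w₀ : W) (k : ℝ) : MeasurableSet (ghostEvent h w₀ ι k) := by
  classical
  have key : ghostEvent h w₀ ι k = ⋃ y : ι × Bool → β,
      (unpair ⁻¹' {x : ι × Bool → α | ∃ w, ∀ j, h w (x j) = y j}) ∩
      ((fun z j => h w₀ (unpair z j)) ⁻¹' {y₀ : ι × Bool → β | (∀ i, y (i, false) = y₀ (i, false)) ∧
        k ≤ ((Finset.univ.filter fun i => y (i, true) ≠ y₀ (i, true)).card : ℝ)}) := by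
    ext z
    simp only [ghostEvent, Set.mem_ofPred_eq, Set.mem_iUnion, Set.mem_inter_iff, Set.mem_preimage]
    constructor
    · rintro ⟨w, h1, h2⟩
      exact ⟨fun j => h w (unpair z j), ⟨w, fun _ => rfl⟩, by simpa [unpair] using h1,
        by simpa [unpair] using h2⟩
    · rintro ⟨y, ⟨w, hw⟩, h1, h2⟩
      obtain rfl : y = fun j => h w (unpair z j) := funext fun j => (hw j).symm
      exact ⟨w, by simpa [unpair] using h1, by simpa [unpair] using h2⟩
  rw [key]
  refine MeasurableSet.iUnion fun y => (measurable_unpair (hproj y)).inter ?_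
  refine measurableSet_preimage ?_ (MeasurableSet.of_discrete)
  exact measurable_pi_lambda _ fun j => (hh w₀).comp ((measurable_pi_apply j).comp measurable_unpair)

/-- Of the `2 ^ |ι|` choices of swaps, those that prescribe the value at every element of a set of
at least `k` indices form a fraction of at most `2 ^ (-k)`. -/
theorem card_filter_agree_le {ι : Type} [Fintype ι] [DecidableEq ι] (I : Finset ι) (τ : ι → Bool)
    {k : ℝ} (hk : k ≤ I.card) :
    ((Finset.univ.filter fun σ : ι → Bool => ∀ i ∈ I, σ i = τ i).card : ℝ) ≤
      2 ^ Fintype.card ι * (2 : ℝ) ^ (-k) := by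
  have h1 : (Finset.univ.filter fun σ : ι → Bool => ∀ i ∈ I, σ i = τ i) =
      Fintype.piFinset fun i => if i ∈ I then {τ i} else Finset.univ := by
    ext σ
    simp only [Finset.mem_filter, Finset.mem_univ, true_and, Fintype.mem_piFinset]
    refine forall_congr' fun i => ?_
    by_cases hi : i ∈ I <;> simp [hi]
  have h2 : (Fintype.piFinset fun i => if i ∈ I then {τ i} else (Finset.univ : Finset Bool)).card *
      2 ^ I.card = 2 ^ Fintype.card ι := by
    rw [Fintype.card_piFinset]
    have : ∀ i, (if i ∈ I then {τ i} else (Finset.univ : Finset Bool)).card =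
        if i ∈ I then 1 else 2 := fun i => by split_ifs <;> simp
    simp_rw [this, Finset.prod_ite]
    simp only [Finset.prod_const_one, Finset.prod_const, one_mul]
    rw [← pow_add, ← Finset.card_univ, Finset.filter_not, Finset.filter_mem_eq_inter,
      Finset.univ_inter, Finset.card_sdiff_add_card_eq_card (Finset.subset_univ I)]
  rw [h1]
  have h3 := congrArg (Nat.cast (R := ℝ)) h2
  push_cast at h3
  rw [← h3, mul_assoc]
  refine le_mul_of_one_le_right (Nat.cast_nonneg _) ?_
  rw [← Real.rpow_natCast, ← Real.rpow_add (by norm_num)]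
  exact Real.one_le_rpow (by norm_num) (by linarith)

-- For a fixed double sample only finitely many label patterns matter. Given a pattern, each pair on
-- which it errs must be turned so that its error lands in the second sample, which prescribes the
-- swap at that index. A union bound over the patterns finishes the count.
open Classical in
theorem card_swapPairs_mem_ghostEvent_le {α β W ι : Type} [Fintype ι] [Finite β] (h : W → α → β)
    (w₀ : W) (k : ℝ) (z : ι → α × α) {Γ : ℝ}
    (hΓ : ((Set.range fun w (j : ι × Bool) => h w (unpair z j)).ncard : ℝ) ≤ Γ) :
    ((Finset.univ.filter fun σ : ι → Bool => swapPairs σ z ∈ ghostEvent h w₀ ι k).card : ℝ) ≤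
      Γ * (2 ^ Fintype.card ι * (2 : ℝ) ^ (-k)) := by
  set Y := (Set.range fun w (j : ι × Bool) => h w (unpair z j)) with hY
  have hYf : Y.Finite := Set.toFinite Y
  let err : (ι × Bool → β) → ι → Bool → Prop := fun y i b => y (i, b) ≠ h w₀ (unpair z (i, b))
  let bad : (ι × Bool → β) → Finset ι := fun y => Finset.univ.filter fun i => ∃ b, err y i b
  -- The first entry of the swapped pair `i` is the entry `(i, σ i)`, so consistency forbids an
  -- error there. At a bad index this forces `σ i` to be the opposite of whether the entry `true`
  -- errs. If both entries err, no swap works, and the condition is merely necessary.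
  let T : (ι × Bool → β) → Finset (ι → Bool) := fun y =>
    if k ≤ (bad y).card then
      Finset.univ.filter fun σ => ∀ i ∈ bad y, σ i = !(decide (err y i true)) else ∅
  have hcover : (Finset.univ.filter fun σ : ι → Bool => swapPairs σ z ∈ ghostEvent h w₀ ι k) ⊆
      hYf.toFinset.biUnion T := by
    intro σ hσ
    simp only [Finset.mem_filter, Finset.mem_univ, true_and] at hσ
    obtain ⟨w, h1, h2⟩ := hσ
    simp only [Finset.mem_biUnion, Set.Finite.mem_toFinset]
    refine ⟨fun j => h w (unpair z j), ⟨w, rfl⟩, ?_⟩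
    have hno : ∀ i, ¬ err (fun j => h w (unpair z j)) i (σ i) := by
      intro i
      have := h1 i
      dsimp only [err]
      rw [not_not]
      cases hs : σ i <;> simpa [swapPairs, hs, unpair] using this
    have hbad : (Finset.univ.filter fun i => h w (swapPairs σ z i).2 ≠ h w₀ (swapPairs σ z i).2) ⊆
        bad (fun j => h w (unpair z j)) := by
      intro i hi
      simp only [Finset.mem_filter, Finset.mem_univ, true_and, bad] at hi ⊢
      refine ⟨!(σ i), ?_⟩
      dsimp only [err]
      cases hs : σ i <;> simpa [swapPairs, hs, unpair] using hi
    have hk : k ≤ (bad (fun j => h w (unpair z j))).card :=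
      h2.trans (by exact_mod_cast Finset.card_le_card hbad)
    dsimp only [T]
    rw [if_pos hk]
    simp only [Finset.mem_filter, Finset.mem_univ, true_and]
    intro i hi
    obtain ⟨b, hb⟩ := (Finset.mem_filter.1 hi).2
    have := hno i
    cases hs : σ i
    · rw [hs] at this
      cases b
      · exact absurd hb this
      · simp [hb]
    · rw [hs] at this
      simp [this]
  have hT : ∀ y, ((T y).card : ℝ) ≤ 2 ^ Fintype.card ι * (2 : ℝ) ^ (-k) := by
    intro y
    dsimp only [T]
    split_ifs with hk
    · exact card_filter_agree_le (bad y) _ hk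
    · simp only [Finset.card_empty, Nat.cast_zero]; positivity
  calc ((Finset.univ.filter fun σ : ι → Bool => swapPairs σ z ∈ ghostEvent h w₀ ι k).card : ℝ)
      ≤ ((hYf.toFinset.biUnion T).card : ℝ) := by exact_mod_cast Finset.card_le_card hcover
    _ ≤ ∑ y ∈ hYf.toFinset, ((T y).card : ℝ) := by exact_mod_cast Finset.card_biUnion_le
    _ ≤ ∑ y ∈ hYf.toFinset, 2 ^ Fintype.card ι * (2 : ℝ) ^ (-k) := Finset.sum_le_sum fun y _ => hT y
    _ = (Y.ncard : ℝ) * (2 ^ Fintype.card ι * (2 : ℝ) ^ (-k)) := by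
      rw [Finset.sum_const, nsmul_eq_mul, Set.ncard_eq_toFinset_card Y hYf]
    _ ≤ _ := by gcongr

/-- Every swap preserves the law of the double sample, so the probability is the mean over all swaps
of the indicator of the swapped event. The combinatorial count bounds that mean for each double
sample separately. -/
theorem measure_ghostEvent_le {α β W ι : Type} [Fintype ι] [MeasurableSpace α] [Finite β]
    (D : Measure α) [IsProbabilityMeasure D] (h : W → α → β) (w₀ : W) (k : ℝ)
    (hm : MeasurableSet (ghostEvent h w₀ ι k)) {Γ : ℝ}
    (hΓ : ∀ x : ι × Bool → α, ((Set.range fun w j => h w (x j)).ncard : ℝ) ≤ Γ) :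
    (Measure.pi fun _ : ι => D.prod D) (ghostEvent h w₀ ι k) ≤
      ENNReal.ofReal (Γ * (2 : ℝ) ^ (-k)) := by
  classical
  set μ := Measure.pi fun _ : ι => D.prod D
  set R := ghostEvent h w₀ ι k
  have h1 : ∀ σ : ι → Bool, ∫⁻ z, R.indicator 1 (swapPairs σ z) ∂μ = μ R := by
    intro σ
    rw [(measurePreserving_swapPairs D σ).lintegral_comp (measurable_one.indicator hm),
      lintegral_indicator_one hm]
  have h2 : (2 : ENNReal) ^ Fintype.card ι * μ R =
      ∫⁻ z, ∑ σ : ι → Bool, R.indicator 1 (swapPairs σ z) ∂μ := by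
    rw [lintegral_finsetSum]
    · simp [h1]
    · intro σ _
      exact (measurable_one.indicator hm).comp (measurePreserving_swapPairs D σ).measurable
  have h3 : ∀ z : ι → α × α, ∑ σ : ι → Bool, R.indicator (1 : (ι → α × α) → ENNReal) (swapPairs σ z) ≤
      ENNReal.ofReal (Γ * (2 ^ Fintype.card ι * (2 : ℝ) ^ (-k))) := by
    intro z
    have h4 : ∑ σ : ι → Bool, R.indicator (1 : (ι → α × α) → ENNReal) (swapPairs σ z) =
        ENNReal.ofReal ((Finset.univ.filter fun σ : ι → Bool => swapPairs σ z ∈ R).card : ℝ) := by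
      simp [Set.indicator_apply]
    rw [h4]
    exact ENNReal.ofReal_le_ofReal
      (card_swapPairs_mem_ghostEvent_le h w₀ k z (hΓ (unpair z)))
  have h5 : (2 : ENNReal) ^ Fintype.card ι * μ R ≤
      2 ^ Fintype.card ι * ENNReal.ofReal (Γ * (2 : ℝ) ^ (-k)) := by
    rw [h2]
    refine (lintegral_mono h3).trans ?_
    rw [lintegral_const, measure_univ, mul_one,
      show Γ * (2 ^ Fintype.card ι * (2 : ℝ) ^ (-k)) = 2 ^ Fintype.card ι * (Γ * (2 : ℝ) ^ (-k)) by
        ring, ENNReal.ofReal_mul (by positivity), ENNReal.ofReal_pow (by norm_num)]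
    simp
  exact (ENNReal.mul_le_mul_iff_right (by simp) (by simp)).1 h5

/-- Uniform convergence in the realizable case, by symmetrization: it is unlikely that a hypothesis
with error more than `ε` is consistent with the sample. -/
theorem measure_exists_consistent_bad_le {α β W : Type} [MeasurableSpace α] [MeasurableSpace β]
    [DiscreteMeasurableSpace β] [Finite β] (D : Measure α) [IsProbabilityMeasure D] (h : W → α → β)
    (hh : ∀ w, Measurable (h w)) (w₀ : W) {M : ℕ}
    (hproj : ∀ y : Fin M × Bool → β,
      MeasurableSet {x : Fin M × Bool → α | ∃ w, ∀ j, h w (x j) = y j})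
    {Γ : ℝ} (hΓ : ∀ x : Fin M × Bool → α, ((Set.range fun w j => h w (x j)).ncard : ℝ) ≤ Γ)
    {ε : ℝ} (hε : 0 < ε) (hM : 6 ≤ ε * M) :
    (Measure.pi fun _ : Fin M => D)
      {S | ∃ w, (∀ i, h w (S i) = h w₀ (S i)) ∧ ENNReal.ofReal ε < D {x | h w x ≠ h w₀ x}} ≤
      ENNReal.ofReal (2 * (Γ * (2 : ℝ) ^ (-(ε * M / 2)))) := by
  classical
  set μ := Measure.pi fun _ : Fin M => D
  set R := ghostEvent h w₀ (Fin M) (ε * M / 2)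
  have hR : MeasurableSet R := measurableSet_ghostEvent h hh hproj w₀ _
  have hmp := measurePreserving_arrowProdEquivProdArrow α α (Fin M) (fun _ => D) (fun _ => D)
  let e := MeasurableEquiv.arrowProdEquivProdArrow α α (Fin M)
  set Q := e.symm ⁻¹' R
  have hQ : MeasurableSet Q := e.symm.measurable hR
  have hQR : (μ.prod μ) Q = (Measure.pi fun _ : Fin M => D.prod D) R :=
    hmp.symm.measure_preimage hR.nullMeasurableSet
  -- If a bad hypothesis survives on `S`, then a fresh sample exposes it with probability at least
  -- `1 / 2`. Markov's inequality for the fibre measure then costs only the factor `2`, and the set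
  -- on the left need not be measurable.
  have hsub : {S : Fin M → α | ∃ w, (∀ i, h w (S i) = h w₀ (S i)) ∧
      ENNReal.ofReal ε < D {x | h w x ≠ h w₀ x}} ⊆
      {S | ENNReal.ofReal (1 / 2) ≤ μ (Prod.mk S ⁻¹' Q)} := by
    rintro S ⟨w, hw, hbad⟩
    have hms : MeasurableSet {x | h w x ≠ h w₀ x} :=
      (measurableSet_eq_fun (hh w) (hh w₀)).compl
    refine (half_le_measure_card_mem D hms hε hbad hM).trans (measure_mono ?_)
    intro T hT
    exact ⟨w, hw, hT⟩
  have h1 := mul_meas_ge_le_lintegral (μ := μ) (measurable_measure_prodMk_left (ν := μ) hQ)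
    (ENNReal.ofReal (1 / 2))
  rw [← Measure.prod_apply hQ, hQR] at h1
  have h2 := h1.trans (measure_ghostEvent_le D h w₀ (ε * M / 2) hR hΓ)
  refine (measure_mono hsub).trans ?_
  rw [ENNReal.ofReal_mul (by norm_num)]
  refine le_trans (le_of_eq ?_) (mul_le_mul_right h2 (ENNReal.ofReal 2))
  rw [← mul_assoc, ← ENNReal.ofReal_mul (by norm_num)]
  norm_num


/-! ### Counting and measurability of half-space patterns -/

theorem sum_choose_le_pow (L d : ℕ) : ∑ k ∈ Finset.Iic d, L.choose k ≤ (L + 1) ^ d := by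
  have h : Finset.Iic d = Finset.range (d + 1) := by
    ext k
    simp
  rw [add_pow, h]
  refine Finset.sum_le_sum fun k hk => ?_
  rw [one_pow, mul_one]
  refine (Nat.choose_le_pow L k).trans (Nat.le_mul_of_pos_right _ (Nat.choose_pos ?_))
  exact Nat.lt_succ_iff.1 (Finset.mem_range.1 hk)

open Classical in
/-- The set of those vectors of the family `v` that have a positive scalar product with `w`. -/
noncomputable def positivePart {J : Type} [Fintype J] {d : ℕ} (v : J → Fin d → ℝ)
    (w : Fin d → ℝ) : Finset J :=
  Finset.univ.filter fun j => 0 < w ⬝ᵥ v j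

-- More than `d` vectors satisfy a nontrivial linear relation. If they were shattered, some `w`
-- would be positive exactly on the vectors with positive coefficient. Pairing the relation with `w`
-- would then give a sum of nonnegative terms, one of them positive, equal to zero.
open Classical in
theorem vcDim_range_positivePart_le {J : Type} [Fintype J] {d : ℕ} (v : J → Fin d → ℝ) :
    (Finset.univ.filter fun P => ∃ w, positivePart v w = P).vcDim ≤ d := by
  refine Finset.sup_le fun s hs => ?_
  rw [Finset.mem_shatterer] at hs
  by_contra! hlt
  have hdep : ¬ LinearIndependent ℝ fun j : s => v j := by
    intro hli
    have := hli.fintype_card_le_finrank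
    simp at this
    omega
  rw [Fintype.not_linearIndependent_iff] at hdep
  obtain ⟨g, hg0, i, hi⟩ := hdep
  -- Negating the relation if necessary makes some coefficient positive; a negative one would not
  -- suffice, since the corresponding product may vanish.
  obtain ⟨c, hc0, i, hi⟩ : ∃ c : s → ℝ, ∑ j, c j • v j = 0 ∧ ∃ i, 0 < c i := by
    rcases lt_or_gt_of_ne hi with h | h
    · refine ⟨-g, ?_, i, by simpa using h⟩
      simpa only [Pi.neg_apply, neg_smul, Finset.sum_neg_distrib, neg_eq_zero] using hg0
    · exact ⟨g, hg0, i, h⟩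
  let t : Finset J := (Finset.univ.filter fun j : s => 0 < c j).map (Function.Embedding.subtype _)
  have ht : t ⊆ s := by
    intro j hj
    simp only [t, Finset.mem_map] at hj
    obtain ⟨a, -, rfl⟩ := hj
    exact a.2
  have htm : ∀ j : s, (j : J) ∈ t ↔ 0 < c j := by
    intro j
    simp [t]
  obtain ⟨u, hu, hut⟩ := hs ht
  obtain ⟨w, rfl⟩ := (Finset.mem_filter.1 hu).2
  have hw : ∀ j : s, 0 < w ⬝ᵥ v j ↔ 0 < c j := by
    intro j
    rw [← htm j, ← hut]
    simp [positivePart]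
  have hsum : ∑ j, c j * (w ⬝ᵥ v j) = 0 := by
    have := congrArg (fun x => w ⬝ᵥ x) hc0
    simpa [dotProduct_sum, dotProduct_smul] using this
  have hnn : ∀ j ∈ Finset.univ, 0 ≤ c j * (w ⬝ᵥ v j) := by
    intro j _
    by_cases hj : 0 < c j
    · exact (mul_pos hj ((hw j).2 hj)).le
    · exact mul_nonneg_of_nonpos_of_nonpos (not_lt.1 hj) (not_lt.1 fun h => hj ((hw j).1 h))
  have := (Finset.sum_eq_zero_iff_of_nonneg hnn).1 hsum i (Finset.mem_univ i)
  exact (mul_pos hi ((hw i).2 hi)).ne' this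

/-- A hyperplane through the origin of `ℝ ^ d` cuts at most `(L + 1) ^ d` different subsets out of
`L` vectors. -/
theorem ncard_range_positivePart_le {J : Type} [Fintype J] {d : ℕ} (v : J → Fin d → ℝ) :
    (Set.range (positivePart v)).ncard ≤ (Fintype.card J + 1) ^ d := by
  classical
  have h1 : Set.range (positivePart v) =
      ↑(Finset.univ.filter fun P => ∃ w, positivePart v w = P) := by
    ext P; simp
  rw [h1, Set.ncard_coe_finset]
  refine (Finset.card_le_card_shatterer _).trans <| Finset.card_shatterer_le_sum_vcDim.trans <|
    (Finset.sum_le_sum_of_subset ?_).trans (sum_choose_le_pow _ d)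
  exact Finset.Iic_subset_Iic.2 (vcDim_range_positivePart_le v)

/-- The vectors from which a hyperplane cuts out a given set form a measurable set, because it is
the projection of a closed set. -/
theorem measurableSet_exists_positivePart_eq {J : Type} [Fintype J] {d : ℕ} (P : Finset J) :
    MeasurableSet {v : J → Fin d → ℝ | ∃ w, positivePart v w = P} := by
  classical
  -- Rescaling `w` allows the open condition `0 <` to be replaced by the closed condition `1 ≤`.
  let C : Set ((J → Fin d → ℝ) × (Fin d → ℝ)) :=
    {p | (∀ j ∈ P, 1 ≤ p.2 ⬝ᵥ p.1 j) ∧ ∀ j ∉ P, p.2 ⬝ᵥ p.1 j ≤ 0}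
  have hdot : ∀ j, Continuous fun p : (J → Fin d → ℝ) × (Fin d → ℝ) => p.2 ⬝ᵥ p.1 j := by
    intro j
    unfold dotProduct
    fun_prop
  have hC : IsClosed C := by
    have : C = (⋂ j ∈ P, {p | 1 ≤ p.2 ⬝ᵥ p.1 j}) ∩ ⋂ j ∉ P, {p | p.2 ⬝ᵥ p.1 j ≤ 0} := by
      ext p; simp [C]
    rw [this]
    exact (isClosed_biInter fun j _ => isClosed_le continuous_const (hdot j)).inter
      (isClosed_biInter fun j _ => isClosed_le (hdot j) continuous_const)
  have hproj : {v : J → Fin d → ℝ | ∃ w, positivePart v w = P} = Prod.fst '' C := by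
    ext v
    simp only [Set.mem_ofPred_eq, Set.mem_image, Prod.exists, exists_and_right, exists_eq_right]
    constructor
    · rintro ⟨w, rfl⟩
      have hpos : ∀ j ∈ positivePart v w, 0 < w ⬝ᵥ v j := fun j hj => by
        simpa [positivePart] using hj
      obtain ⟨c, hc, hcj⟩ : ∃ c : ℝ, 0 < c ∧ ∀ j ∈ positivePart v w, 1 ≤ c * (w ⬝ᵥ v j) := by
        -- The sum dominates each inverse; the summand `1` keeps the factor positive when the set is
        -- empty.
        refine ⟨1 + ∑ j ∈ positivePart v w, (w ⬝ᵥ v j)⁻¹, ?_, fun j hj => ?_⟩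
        · have : 0 ≤ ∑ j ∈ positivePart v w, (w ⬝ᵥ v j)⁻¹ :=
            Finset.sum_nonneg fun j hj => (inv_pos.2 (hpos j hj)).le
          linarith
        · have h1 : (w ⬝ᵥ v j)⁻¹ ≤ ∑ j ∈ positivePart v w, (w ⬝ᵥ v j)⁻¹ :=
            Finset.single_le_sum (f := fun j => (w ⬝ᵥ v j)⁻¹)
              (fun j hj => (inv_pos.2 (hpos j hj)).le) hj
          rw [← div_le_iff₀ (hpos j hj), one_div]
          linarith
      refine ⟨c • w, fun j hj => by simpa [smul_dotProduct] using hcj j hj, fun j hj => ?_⟩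
      have : w ⬝ᵥ v j ≤ 0 := by simpa [positivePart] using hj
      simpa [smul_dotProduct] using mul_nonpos_of_nonneg_of_nonpos hc.le this
    · rintro ⟨w, h1, h2⟩
      refine ⟨w, ?_⟩
      ext j
      simp only [positivePart, Finset.mem_filter, Finset.mem_univ, true_and]
      by_cases hj : j ∈ P
      · simpa [hj] using zero_lt_one.trans_le (h1 j hj)
      · simpa [hj] using h2 j hj
  rw [hproj]
  -- A projection of a closed set need not be closed, but in Euclidean space it is a countable union
  -- of compact sets.
  have hσ : IsSigmaCompact (Prod.fst '' C) :=
    (isSigmaCompact_univ.of_isClosed_subset hC (Set.subset_univ C)).image continuous_fst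
  obtain ⟨K, hK, hKu⟩ := hσ
  rw [← hKu]
  exact MeasurableSet.iUnion fun n => (hK n).isClosed.measurableSet

/-! ### Learning classes determined by sign vectors -/

/-- A class of hypotheses that depend on the instance through a discrete code and on the parameter
through the signs of finitely many scalar products with features of the instance. -/
structure SignClass (α β γ J : Type) [Fintype J] (d : ℕ) where
  code : α → γ
  feature : α → J → Fin d → ℝ
  decode : γ → Finset J → β

namespace SignClass

variable {α β γ J : Type} [Fintype J] {d : ℕ}

/-- The hypothesis with parameter `w`. -/
noncomputable def hyp (c : SignClass α β γ J d) (w : Fin d → ℝ) (x : α) : β :=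
  c.decode (c.code x) (positivePart (c.feature x) w)

theorem ncard_range_le (c : SignClass α β γ J d) {ι : Type} [Fintype ι] (x : ι → α) :
    (Set.range fun w i => c.hyp w (x i)).ncard ≤ (Fintype.card ι * Fintype.card J + 1) ^ d := by
  classical
  -- All instances share the same `w`, so their vectors are pooled into one family. This keeps the
  -- exponent at `d` rather than `d` times the number of instances.
  let v : ι × J → Fin d → ℝ := fun p => c.feature (x p.1) p.2
  let F : Finset (ι × J) → ι → β := fun P i =>
    c.decode (c.code (x i)) (Finset.univ.filter fun j => (i, j) ∈ P)
  have h1 : (Set.range fun w i => c.hyp w (x i)) = F '' Set.range (positivePart v) := by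
    rw [← Set.range_comp]
    congr 1
    ext w i
    simp only [hyp, Function.comp, F]
    congr 1
    ext j
    simp [positivePart, v]
  rw [h1]
  refine (Set.ncard_image_le (Set.toFinite _)).trans ?_
  simpa using ncard_range_positivePart_le v

variable [MeasurableSpace α] [MeasurableSpace γ] [Finite γ] [DiscreteMeasurableSpace γ]

theorem measurableSet_exists_hyp_eq (c : SignClass α β γ J d) (hcode : Measurable c.code)
    (hfeature : Measurable c.feature) {ι : Type} [Fintype ι] (y : ι → β) :
    MeasurableSet {x : ι → α | ∃ w, ∀ i, c.hyp w (x i) = y i} := by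
  classical
  let F : (ι → γ) → Finset (ι × J) → ι → β := fun g P i =>
    c.decode (g i) (Finset.univ.filter fun j => (i, j) ∈ P)
  let V : (ι → α) → ι × J → Fin d → ℝ := fun x p => c.feature (x p.1) p.2
  have hV : Measurable V := measurable_pi_lambda _ fun p =>
    (measurable_pi_apply p.2).comp (hfeature.comp (measurable_pi_apply p.1))
  have hF : ∀ w (x : ι → α), (fun i => c.hyp w (x i)) =
      F (fun i => c.code (x i)) (positivePart (V x) w) := by
    intro w x
    ext i
    simp only [hyp, F]
    congr 1
    ext j
    simp [positivePart, V]
  have key : {x : ι → α | ∃ w, ∀ i, c.hyp w (x i) = y i} =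
      ⋃ g : ι → γ, ⋃ P : Finset (ι × J), ⋃ _ : F g P = y,
        ((fun x i => c.code (x i)) ⁻¹' {g}) ∩ V ⁻¹' {v | ∃ w, positivePart v w = P} := by
    ext x
    simp only [Set.mem_ofPred_eq, Set.mem_iUnion, Set.mem_inter_iff, Set.mem_preimage,
      Set.mem_singleton_iff]
    simp_rw [← funext_iff (f := fun i => c.hyp _ (x i)), hF]
    constructor
    · rintro ⟨w, hw⟩
      exact ⟨_, _, hw, rfl, w, rfl⟩
    · rintro ⟨g, P, hy, rfl, w, rfl⟩
      exact ⟨w, hy⟩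
  rw [key]
  refine MeasurableSet.iUnion fun g => MeasurableSet.iUnion fun P => MeasurableSet.iUnion fun _ =>
    MeasurableSet.inter ?_ (hV (measurableSet_exists_positivePart_eq P))
  exact measurableSet_preimage
    (measurable_pi_lambda _ fun i => hcode.comp (measurable_pi_apply i)) (measurableSet_singleton g)

theorem measurable_hyp [MeasurableSpace β] (c : SignClass α β γ J d) (hcode : Measurable c.code)
    (hfeature : Measurable c.feature) (w : Fin d → ℝ) : Measurable (c.hyp w) := by
  classical
  let _ : MeasurableSpace (Finset J) := ⊤
  have h1 : Measurable fun x => positivePart (c.feature x) w := by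
    refine measurable_to_countable' fun P => ?_
    have : (fun x => positivePart (c.feature x) w) ⁻¹' {P} =
        ⋂ j, {x | 0 < w ⬝ᵥ c.feature x j ↔ j ∈ P} := by
      ext x
      simp [positivePart, Finset.ext_iff]
    rw [this]
    refine MeasurableSet.iInter fun j => ?_
    have hm : Measurable fun x => w ⬝ᵥ c.feature x j := by
      unfold dotProduct
      refine Finset.measurable_sum _ fun i _ => measurable_const.mul ?_
      exact (measurable_pi_apply i).comp ((measurable_pi_apply j).comp hfeature)
    exact (measurableSet_lt measurable_const hm).iff (MeasurableSet.const _)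
  have h2 : Measurable fun p : γ × Finset J => c.decode p.1 p.2 := measurable_of_countable _
  exact h2.comp (hcode.prodMk h1)

end SignClass

open Classical in
/-- Empirical risk minimization: return a hypothesis that is consistent with the sample. -/
noncomputable def consistentLearner {α β W : Type} [Nonempty W] (h : W → α → β) :
    Learner α β W := fun _ S =>
  if hS : ∃ w, ∀ i, h w (S i).1 = (S i).2 then hS.choose else Classical.arbitrary W

theorem consistentLearner_spec {α β W : Type} [Nonempty W] (h : W → α → β) {M : ℕ}
    (S : Fin M → α × β) (w : W) (hw : ∀ i, h w (S i).1 = (S i).2) (i : Fin M) :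
    h (consistentLearner h M S) (S i).1 = (S i).2 := by
  have hS : ∃ w, ∀ i, h w (S i).1 = (S i).2 := ⟨w, hw⟩
  rw [consistentLearner, dif_pos hS]
  exact hS.choose_spec i

theorem SignClass.learnsWith {α β γ J : Type} [Fintype J] {d : ℕ} [MeasurableSpace α]
    [MeasurableSpace γ] [Finite γ] [DiscreteMeasurableSpace γ] [Finite β]
    (c : SignClass α β γ J d) (hcode : Measurable c.code) (hfeature : Measurable c.feature)
    {ε δ : ℝ} (hε : 0 < ε) {M : ℕ} (hM : 6 ≤ ε * M)
    (hδ : 2 * ((M * 2 * Fintype.card J + 1 : ℝ) ^ d * (2 : ℝ) ^ (-(ε * M / 2))) ≤ δ) :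
    LearnsWith c.hyp (consistentLearner c.hyp) ε δ M := by
  let _ : MeasurableSpace β := ⊤
  rintro D hD f ⟨w₀, hw₀⟩
  have hbad := measure_exists_consistent_bad_le D c.hyp (c.measurable_hyp hcode hfeature) w₀ (M := M)
    (c.measurableSet_exists_hyp_eq hcode hfeature)
    (Γ := (M * 2 * Fintype.card J + 1 : ℝ) ^ d)
    (fun x => by
      have := c.ncard_range_le x
      simp only [Fintype.card_prod, Fintype.card_fin, Fintype.card_bool] at this
      exact_mod_cast this) hε hM
  -- The labelling agrees with `w₀` only almost surely; outside this null set the sample is labelled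
  -- by `w₀` and a consistent hypothesis exists.
  have hnull : (Measure.pi fun _ : Fin M => D) {S | ¬ ∀ i, c.hyp w₀ (S i) = f (S i)} = 0 := by
    have : ∀ᵐ S ∂(Measure.pi fun _ : Fin M => D), ∀ i, c.hyp w₀ (S i) = f (S i) := by
      rw [ae_all_iff]
      intro i
      exact (Measure.quasiMeasurePreserving_eval (fun _ : Fin M => D) i).ae hw₀
    exact this
  have hsub : {S : Fin M → α | ENNReal.ofReal ε <
      D {x | c.hyp (consistentLearner c.hyp M fun i => (S i, f (S i))) x ≠ f x}} ⊆
      {S | ∃ w, (∀ i, c.hyp w (S i) = c.hyp w₀ (S i)) ∧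
        ENNReal.ofReal ε < D {x | c.hyp w x ≠ c.hyp w₀ x}} ∪
      {S | ¬ ∀ i, c.hyp w₀ (S i) = f (S i)} := by
    intro S hS
    by_cases hc : ∀ i, c.hyp w₀ (S i) = f (S i)
    · left
      refine ⟨consistentLearner c.hyp M fun i => (S i, f (S i)), fun i => ?_, ?_⟩
      · rw [hc i]
        exact consistentLearner_spec c.hyp (fun i => (S i, f (S i))) w₀ hc i
      · refine lt_of_lt_of_eq hS (measure_congr ?_)
        filter_upwards [hw₀] with x hx
        apply propext
        change _ ≠ _ ↔ _ ≠ _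
        rw [hx]
    · right
      exact hc
  refine (measure_mono hsub).trans <| (measure_union_le _ _).trans ?_
  rw [hnull, add_zero]
  exact hbad.trans (ENNReal.ofReal_le_ofReal hδ)


/-! ### Numerical estimate of the sample size -/

theorem log_two_le_log_div {a ε : ℝ} {d : ℕ} (ha : 2 ≤ a) (hd : 1 ≤ d) (hε : 0 < ε) (hε1 : ε < 1) :
    Real.log 2 ≤ Real.log (a * d / ε) := by
  have hd' : (1 : ℝ) ≤ d := by exact_mod_cast hd
  apply Real.log_le_log (by norm_num)
  rw [le_div_iff₀ hε]
  nlinarith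

/-- The sample sizes at which the growth function of a class of sign vectors is dominated by the
exponentially small probability that a single bad hypothesis survives. -/
theorem growth_mul_rpow_le {K a ε δ : ℝ} {d M : ℕ} (hd : 1 ≤ d) (hK0 : 0 ≤ K) (ha : 2 ≤ a)
    (hK : K ≤ 9 * a) (hε : 0 < ε) (hε1 : ε < 1) (hδ : 0 < δ) (hδ1 : δ < 1)
    (hM : 100 * sampleBound a d ε δ ≤ M) :
    6 ≤ ε * M ∧ 2 * ((M * 2 * (K * K) + 1 : ℝ) ^ d * (2 : ℝ) ^ (-(ε * M / 2))) ≤ δ := by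
  have hd' : (1 : ℝ) ≤ d := by exact_mod_cast hd
  have hlog1 := Real.log_two_gt_d9
  have hlog2 := Real.log_two_lt_d9
  set l := Real.log (a * d / ε) with hl
  have hL : Real.log 2 ≤ l := log_two_le_log_div ha hd hε hε1
  have hlδ : 0 ≤ Real.log (1 / δ) := Real.log_nonneg (by rw [le_div_iff₀ hδ]; linarith)
  have hM' : 100 * (a * d * l ^ 2 + Real.log (1 / δ)) ≤ ε * M := by
    have h := mul_le_mul_of_nonneg_left hM hε.le
    rw [sampleBound, ← hl] at h
    refine le_of_eq_of_le ?_ h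
    field_simp
  have had : 2 * (d : ℝ) ≤ a * d := by nlinarith
  have hdl : d * l ≤ (3 / 4) * (a * d * l ^ 2) := by
    have h1 : 2 * d * l ^ 2 ≤ a * d * l ^ 2 := by gcongr
    have h2 : d * l * 0.69 ≤ d * l * l := by
      have : 0 ≤ d * l := by nlinarith
      gcongr; linarith
    nlinarith
  have hq : 0.69 ≤ d * l := by nlinarith
  have h6 : 6 ≤ ε * M := by nlinarith
  refine ⟨h6, ?_⟩
  have hMpos : (0 : ℝ) < M := by
    by_contra! h
    nlinarith
  have hM1 : (1 : ℝ) ≤ M := by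
    have : 0 < M := by exact_mod_cast hMpos
    exact_mod_cast this
  have hbase : (M * 2 * (K * K) + 1 : ℝ) ≤ 243 * M * a ^ 2 := by
    have h1 : K * K ≤ 9 * a * (9 * a) := by gcongr
    have h2 : (1 : ℝ) ≤ M * a ^ 2 := by nlinarith
    nlinarith
  have hbase0 : (0 : ℝ) < M * 2 * (K * K) + 1 := by positivity
  have hapos : 0 < a := by linarith
  have hdpos : (0 : ℝ) < d := by linarith
  have hlogb : Real.log (M * 2 * (K * K) + 1) ≤ ε * M / (20 * d) + 15 * l := by
    -- The split isolates the dependence on `M`: `log x ≤ x - 1` makes the first factor a small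
    -- multiple of `ε * M`, absorbed later by the exponential decay. The second contributes `13 *
    -- log 2 + 2 * l ≤ 15 * l`. It suffices that `2 ^ 13 / 20 ≥ 243`.
    have h1 : (243 * M * a ^ 2 : ℝ) ≤ (ε * M / (20 * d)) * (2 ^ 13 * (a * d / ε) ^ 2) := by
      have h2 : (ε * M / (20 * d)) * (2 ^ 13 * (a * d / ε) ^ 2) =
          (2 ^ 13 / 20) * (M * a ^ 2) * (d / ε) := by
        field_simp
      rw [h2]
      have h3 : (1 : ℝ) ≤ d / ε := by rw [le_div_iff₀ hε]; linarith
      have h4 : (0 : ℝ) ≤ M * a ^ 2 := by positivity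
      nlinarith
    have hx : 0 < ε * M / (20 * d) := by positivity
    have hy : 0 < a * d / ε := by positivity
    calc Real.log (M * 2 * (K * K) + 1)
        ≤ Real.log ((ε * M / (20 * d)) * (2 ^ 13 * (a * d / ε) ^ 2)) :=
          Real.log_le_log hbase0 (hbase.trans h1)
      _ = Real.log (ε * M / (20 * d)) + (13 * Real.log 2 + 2 * l) := by
          rw [Real.log_mul hx.ne' (by positivity), Real.log_mul (by positivity) (by positivity),
            Real.log_pow, Real.log_pow]
          norm_num [hl]
      _ ≤ _ := by
          have := Real.log_le_sub_one_of_pos hx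
          linarith
  have hdlog : d * Real.log (M * 2 * (K * K) + 1) ≤ ε * M / 20 + 15 * (d * l) := by
    refine (mul_le_mul_of_nonneg_left hlogb hdpos.le).trans (le_of_eq ?_)
    field_simp
  have hpos : 0 < 2 * ((M * 2 * (K * K) + 1 : ℝ) ^ d * (2 : ℝ) ^ (-(ε * M / 2))) := by positivity
  rw [← Real.log_le_log_iff hpos hδ, Real.log_mul (by norm_num) (by positivity),
    Real.log_mul (by positivity) (by positivity), Real.log_pow, Real.log_rpow (by norm_num)]
  have hlδ' : Real.log δ = -Real.log (1 / δ) := by rw [one_div, Real.log_inv, neg_neg]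
  rw [hlδ']
  nlinarith

/-! ### Edge selection as a sign class -/

open Classical in
/-- Edge selection as a class of sign vectors: the features of `G` are compared for every pair of
potential edges. -/
noncomputable def edgeSignClass {V : Type} [Fintype V] {X : Set (Network V)} {d : ℕ}
    (tie : Finset (V × V) → V × V) (φ : X → V × V → Fin d → ℝ) :
    SignClass X (V × V) (Finset (V × V)) (edgeMax X × edgeMax X) d where
  code G := G.1.edges
  feature G p := φ G p.2 - φ G p.1
  -- A pair in `P` records that its second edge scores strictly higher than its first, so the edges
  -- kept are those that no edge of `E` beats.
  decode E P := tie (E.filter fun e => ∀ e' ∈ E, ∀ p ∈ P, ¬ (p.1.1 = e ∧ p.2.1 = e'))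

theorem mem_edgeMax {V : Type} [Fintype V] {X : Set (Network V)} {e : V × V} :
    e ∈ edgeMax X ↔ ∃ N ∈ X, e ∈ N.edges := by
  simp [edgeMax]

theorem edgeSignClass_hyp {V : Type} [Fintype V] {X : Set (Network V)} {d : ℕ}
    (tie : Finset (V × V) → V × V) (φ : X → V × V → Fin d → ℝ) :
    (edgeSignClass tie φ).hyp = edgeSelector tie φ := by
  classical
  ext1 w
  ext1 G
  simp only [SignClass.hyp, edgeSignClass, edgeSelector, argmaxEdges]
  congr 1
  ext e
  simp only [Finset.mem_filter]
  refine and_congr_right fun he => forall₂_congr fun e' he' => ?_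
  have hm : ∀ e ∈ G.1.edges, e ∈ edgeMax X := fun e he => mem_edgeMax.2 ⟨G.1, G.2, he⟩
  simp only [positivePart, Finset.mem_filter, Finset.mem_univ, true_and, dotProduct_sub, sub_pos]
  constructor
  · intro h
    by_contra! hlt
    exact h (⟨e, hm e he⟩, ⟨e', hm e' he'⟩) hlt ⟨rfl, rfl⟩
  · rintro h p hp ⟨rfl, rfl⟩
    exact absurd hp (not_lt.2 h)

theorem measurable_edges {V : Type} :
    @Measurable (Network V) (Finset (V × V)) _ ⊤ fun N => N.edges :=
  measurable_iff_comap_le.2 le_sup_left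

theorem pacLearnableWith_edgeSelector {V : Type} [Fintype V] {X : Set (Network V)} {d : ℕ}
    (hd : 1 ≤ d) (tie : Finset (V × V) → V × V) (φ : X → V × V → Fin d → ℝ)
    (hφ : ∀ e, Measurable fun G => φ G e) {a : ℝ} (ha : 2 ≤ a) (hX : (edgeMax X).card ≤ 9 * a) :
    PACLearnableWith (edgeSelector tie φ) (fun ε δ => 100 * sampleBound a d ε δ) := by
  refine ⟨consistentLearner (edgeSelector tie φ), fun ε δ hε hε1 hδ hδ1 M hM => ?_⟩
  rw [← edgeSignClass_hyp]
  let _ : MeasurableSpace (Finset (V × V)) := ⊤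
  obtain ⟨h6, hg⟩ := growth_mul_rpow_le hd (Nat.cast_nonneg _) ha hX hε hε1 hδ hδ1 hM
  refine SignClass.learnsWith _ ?_ ?_ hε h6 ?_
  · exact measurable_edges.comp measurable_subtype_coe
  · exact measurable_pi_lambda _ fun p => (hφ p.2).sub (hφ p.1)
  · simpa using hg

/-- With at most one potential edge the logarithm in the bound may be close to zero and the general
estimate fails. This degenerate case needs no sample because all hypotheses coincide. -/
theorem edgeSelector_eq_of_card_le_one {V : Type} [Fintype V] {X : Set (Network V)} {d : ℕ}
    (hX : (edgeMax X).card ≤ 1) (tie : Finset (V × V) → V × V) (φ : X → V × V → Fin d → ℝ)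
    (w w' : Fin d → ℝ) : edgeSelector tie φ w = edgeSelector tie φ w' := by
  classical
  ext1 G
  have hall : ∀ w, argmaxEdges φ w G = G.1.edges := by
    intro w
    ext e
    simp only [argmaxEdges, Finset.mem_filter]
    refine and_iff_left_of_imp fun he e' he' => ?_
    rw [Finset.card_le_one.1 hX e (mem_edgeMax.2 ⟨G.1, G.2, he⟩) e'
      (mem_edgeMax.2 ⟨G.1, G.2, he'⟩)]
  rw [edgeSelector, edgeSelector, hall, hall]

theorem pacLearnableWith_of_card_le_one {V : Type} [Fintype V] {X : Set (Network V)} {d : ℕ}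
    (hX : (edgeMax X).card ≤ 1) (tie : Finset (V × V) → V × V) (φ : X → V × V → Fin d → ℝ)
    (r : ℝ → ℝ → ℝ) : PACLearnableWith (edgeSelector tie φ) r := by
  refine ⟨fun _ _ => 0, fun ε δ _ _ _ _ M _ => ?_⟩
  rintro D - f ⟨w, hw⟩
  have h0 : D {x | edgeSelector tie φ 0 x ≠ f x} = 0 := by
    rw [edgeSelector_eq_of_card_le_one hX tie φ 0 w]
    exact hw
  simp [h0]

/-! ### Edge counts -/

theorem card_gridVertex (m : ℕ) : Fintype.card (GridVertex m) = m ^ 2 + 2 := by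
  simp [GridVertex, Pixel, sq]

theorem allEdges_eq (m : ℕ) :
    allEdges m = Fintype.card (GridVertex m) * (Fintype.card (GridVertex m) - 1) := by
  classical
  have h : edgeMax (Set.univ : Set (Network (GridVertex m))) = Finset.univ.offDiag := by
    ext e
    rw [mem_edgeMax]
    simp only [Set.mem_univ, true_and, Finset.mem_offDiag, Finset.mem_univ]
    constructor
    · rintro ⟨N, hN⟩
      exact N.loopless e hN
    · intro he
      exact ⟨⟨{e}, by simpa using he, 0, fun _ => le_rfl, fun _ _ => rfl⟩, by simp⟩
  rw [allEdges, h, Finset.offDiag_card, Finset.card_univ, Nat.mul_sub, mul_one]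

/-- The possible edges at a pixel in a grid network: those to its four neighbours (a step that would
leave the image is replaced by none), the one from the source and the one to the sink. -/
def gridEdgeAt {m : ℕ} (p : Pixel m) : Fin 6 → GridVertex m × GridVertex m
  | 0 => (Sum.inl p, Sum.inl (p.1, if h : p.2.val + 1 < m then ⟨p.2.val + 1, h⟩ else p.2))
  | 1 => (Sum.inl p, Sum.inl (p.1, ⟨p.2.val - 1, by omega⟩))
  | 2 => (Sum.inl p, Sum.inl (if h : p.1.val + 1 < m then ⟨p.1.val + 1, h⟩ else p.1, p.2))
  | 3 => (Sum.inl p, Sum.inl (⟨p.1.val - 1, by omega⟩, p.2))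
  | 4 => (source m, Sum.inl p)
  | 5 => (Sum.inl p, sink m)

theorem exists_gridEdgeAt_eq {m : ℕ} {S T : Finset (Pixel m)} {e : GridVertex m × GridVertex m}
    (he : IsGridEdge S T e) : ∃ p k, gridEdgeAt p k = e := by
  rcases he with ⟨⟨p1, p2⟩, ⟨q1, q2⟩, hpq, rfl⟩ | ⟨p, -, rfl⟩ | ⟨p, -, rfl⟩
  · rcases hpq with ⟨h1, h2 | h2⟩ | ⟨h1, h2 | h2⟩ <;> simp only at h1 h2 <;> subst h1
    · refine ⟨(p1, p2), 0, ?_⟩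
      simp [gridEdgeAt, h2]
    · refine ⟨(p1, p2), 1, ?_⟩
      simp [gridEdgeAt, ← h2]
    · refine ⟨(p1, p2), 2, ?_⟩
      simp [gridEdgeAt, h2]
    · refine ⟨(p1, p2), 3, ?_⟩
      simp [gridEdgeAt, ← h2]
  · exact ⟨p, 4, rfl⟩
  · exact ⟨p, 5, rfl⟩

theorem card_edgeMax_grid_le {m : ℕ} {X : Set (Network (GridVertex m))} (hX : X ⊆ gridNetworks m) :
    (edgeMax X).card ≤ 6 * Fintype.card (GridVertex m) := by
  classical
  -- At the border some of the six candidates are loops, hence not edges; only an upper bound is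
  -- needed.
  have hsub : edgeMax X ⊆
      Finset.univ.image fun q : Pixel m × Fin 6 => gridEdgeAt q.1 q.2 := by
    intro e he
    obtain ⟨N, hN, heN⟩ := mem_edgeMax.1 he
    obtain ⟨S, T, hST⟩ := hX hN
    obtain ⟨p, k, hpk⟩ := exists_gridEdgeAt_eq ((hST e).1 heN)
    exact Finset.mem_image.2 ⟨(p, k), Finset.mem_univ _, hpk⟩
  refine (Finset.card_le_card hsub).trans (Finset.card_image_le.trans ?_)
  simp only [Finset.card_univ, Fintype.card_prod, Fintype.card_fin, Fintype.card_sum,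
    Fintype.card_bool]
  omega

/-- A family of grid networks never uses the edge from the source to the sink. -/
theorem card_edgeMax_grid_lt {m : ℕ} {X : Set (Network (GridVertex m))} (hX : X ⊆ gridNetworks m) :
    (edgeMax X).card < allEdges m := by
  refine Finset.card_lt_card ⟨fun e he => ?_, fun hsub => ?_⟩
  · obtain ⟨N, -, heN⟩ := mem_edgeMax.1 he
    exact mem_edgeMax.2 ⟨N, Set.mem_univ _, heN⟩
  · have h1 : (source m, sink m) ∈ edgeMax (Set.univ : Set (Network (GridVertex m))) :=
      mem_edgeMax.2 ⟨⟨{(source m, sink m)}, by simp [source, sink], 0, fun _ => le_rfl,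
        fun _ _ => rfl⟩, Set.mem_univ _, by simp⟩
    obtain ⟨N, hN, heN⟩ := mem_edgeMax.1 (hsub h1)
    obtain ⟨S, T, hST⟩ := hX hN
    rcases (hST _).1 heN with ⟨p, q, -, h⟩ | ⟨p, -, h⟩ | ⟨p, -, h⟩ <;>
      simp [source, sink] at h


/-! ### Comparison of the bounds -/

/-- For `1 ≤ K` the smaller logarithm is nonnegative, so squaring preserves the order. For `0 < K <
1` it could be negative with a large square, which is why `K` is zero or at least `1`. -/
theorem mul_log_sq_le {K E ε : ℝ} {d : ℕ} (hd : 1 ≤ d) (hε : 0 < ε) (hε1 : ε < 1)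
    (hK : K = 0 ∨ 1 ≤ K) (hKE : K ≤ E) :
    K * d * Real.log (K * d / ε) ^ 2 ≤ K * d * Real.log (E * d / ε) ^ 2 := by
  rcases hK with rfl | hK
  · simp
  have hd' : (1 : ℝ) ≤ d := by exact_mod_cast hd
  have h1 : 0 ≤ Real.log (K * d / ε) :=
    Real.log_nonneg (by rw [le_div_iff₀ hε]; nlinarith)
  gcongr

theorem sampleBound_lt {K E ε δ : ℝ} {d : ℕ} (hd : 1 ≤ d) (hε : 0 < ε) (hε1 : ε < 1)
    (hK : K = 0 ∨ 1 ≤ K) (hKE : K < E) (hE : 2 ≤ E) :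
    sampleBound K d ε δ < sampleBound E d ε δ := by
  have hd' : (0 : ℝ) < d := by exact_mod_cast hd
  have hl := log_two_le_log_div hE hd hε hε1
  have hl0 : 0 < Real.log (E * d / ε) := (Real.log_pos (by norm_num)).trans_le hl
  have h1 := mul_log_sq_le hd hε hε1 hK hKE.le
  have h2 : K * d * Real.log (E * d / ε) ^ 2 < E * d * Real.log (E * d / ε) ^ 2 := by gcongr
  unfold sampleBound
  refine div_lt_div_of_pos_right ?_ hε
  linarith

/-- In the numerator the logarithm is enlarged to that of the denominator, where it cancels; in the
denominator `log (1 / δ)` is dropped and the remaining logarithm is at least `log 2`. -/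
theorem sampleBound_div_le {K E ε δ : ℝ} {d : ℕ} (hd : 1 ≤ d) (hε : 0 < ε) (hε1 : ε < 1)
    (hδ : 0 < δ) (hδ1 : δ < 1) (hK : K = 0 ∨ 1 ≤ K) (hKE : K ≤ E) (hE : 2 ≤ E) :
    sampleBound K d ε δ / sampleBound E d ε δ ≤
      K / E + Real.log (1 / δ) / Real.log 2 ^ 2 * E⁻¹ := by
  have hd' : (1 : ℝ) ≤ d := by exact_mod_cast hd
  have hlog2 : 0 < Real.log 2 := Real.log_pos (by norm_num)
  have hl := log_two_le_log_div hE hd hε hε1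
  set l := Real.log (E * d / ε) with hldef
  have hl0 : 0 < l := hlog2.trans_le hl
  have hlδ : 0 ≤ Real.log (1 / δ) := Real.log_nonneg (by rw [le_div_iff₀ hδ]; linarith)
  have hK0 : 0 ≤ K := by rcases hK with rfl | h <;> linarith
  have hEpos : 0 < E := by linarith
  have h1 := mul_log_sq_le hd hε hε1 hK hKE
  have hA : 0 < E * d * l ^ 2 := by positivity
  have hlE : E * Real.log 2 ^ 2 ≤ E * d * l ^ 2 := by
    have : Real.log 2 ^ 2 ≤ l ^ 2 := by gcongr
    have h3 : E ≤ E * d := le_mul_of_one_le_right hEpos.le hd'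
    gcongr
  unfold sampleBound
  rw [div_div_div_cancel_right₀ hε.ne', ← hldef]
  rw [← hldef] at h1
  calc (K * d * Real.log (K * d / ε) ^ 2 + Real.log (1 / δ)) / (E * d * l ^ 2 + Real.log (1 / δ))
      ≤ (K * d * l ^ 2 + Real.log (1 / δ)) / (E * d * l ^ 2) := by
        gcongr
        linarith
    _ = K / E + Real.log (1 / δ) / (E * d * l ^ 2) := by
        field_simp
    _ ≤ K / E + Real.log (1 / δ) / (E * Real.log 2 ^ 2) := by gcongr
    _ = _ := by field_simp

theorem sampleBound_nonneg {K ε δ : ℝ} {d : ℕ} (hε : 0 < ε) (hδ : 0 < δ) (hδ1 : δ < 1)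
    (hK : 0 ≤ K) : 0 ≤ sampleBound K d ε δ := by
  have hlδ : 0 ≤ Real.log (1 / δ) := Real.log_nonneg (by rw [le_div_iff₀ hδ]; linarith)
  unfold sampleBound
  positivity

theorem tendsto_sampleBound_div {K E : ℕ → ℝ} {ε δ : ℝ} {d : ℕ} (hd : 1 ≤ d) (hε : 0 < ε)
    (hε1 : ε < 1) (hδ : 0 < δ) (hδ1 : δ < 1) (hK : ∀ m, K m = 0 ∨ 1 ≤ K m) (hKE : ∀ m, K m ≤ E m)
    (hE : Tendsto E atTop atTop) (hlim : Tendsto (fun m => K m / E m) atTop (𝓝 0)) :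
    Tendsto (fun m => sampleBound (K m) d ε δ / sampleBound (E m) d ε δ) atTop (𝓝 0) := by
  have hup : Tendsto (fun m => K m / E m + Real.log (1 / δ) / Real.log 2 ^ 2 * (E m)⁻¹)
      atTop (𝓝 0) := by
    simpa using hlim.add ((tendsto_inv_atTop_zero.comp hE).const_mul
      (Real.log (1 / δ) / Real.log 2 ^ 2))
  refine tendsto_of_tendsto_of_tendsto_of_le_of_le' tendsto_const_nhds hup ?_ ?_
  · filter_upwards [hE.eventually_ge_atTop 2] with m hm
    have hK0 : 0 ≤ K m := by rcases hK m with h | h <;> linarith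
    exact div_nonneg (sampleBound_nonneg hε hδ hδ1 hK0)
      (sampleBound_nonneg hε hδ hδ1 (by linarith))
  · filter_upwards [hE.eventually_ge_atTop 2] with m hm
    exact sampleBound_div_le hd hε hε1 hδ hδ1 (hK m) (hKE m) hm

theorem allEdges_cast (m : ℕ) : (allEdges m : ℝ) = ((m : ℝ) ^ 2 + 2) * ((m : ℝ) ^ 2 + 1) := by
  rw [allEdges_eq, card_gridVertex]
  push_cast
  ring

theorem tendsto_allEdges : Tendsto (fun m => (allEdges m : ℝ)) atTop atTop := by
  refine tendsto_atTop_mono (fun m => ?_) tendsto_natCast_atTop_atTop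
  rw [allEdges_cast]
  nlinarith [sq_nonneg ((m : ℝ) - 1), sq_nonneg ((m : ℝ) ^ 2), sq_nonneg (m : ℝ)]

theorem natCast_eq_zero_or_one_le (k : ℕ) : (k : ℝ) = 0 ∨ (1 : ℝ) ≤ k := by
  rcases Nat.eq_zero_or_pos k with h | h
  · left; exact_mod_cast h
  · right; exact_mod_cast h

theorem tendsto_card_edgeMax_div {X : ∀ m : ℕ, Set (Network (GridVertex m))}
    (hX : ∀ m, X m ⊆ gridNetworks m) :
    Tendsto (fun m => ((edgeMax (X m)).card : ℝ) / allEdges m) atTop (𝓝 0) := by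
  have h : Tendsto (fun m : ℕ => (6 : ℝ) * ((m : ℝ) ^ 2 + 1)⁻¹) atTop (𝓝 0) := by
    have h1 : Tendsto (fun m : ℕ => (m : ℝ) ^ 2 + 1) atTop atTop :=
      tendsto_atTop_add_const_right _ _
        ((tendsto_pow_atTop two_ne_zero).comp tendsto_natCast_atTop_atTop)
    simpa using (tendsto_inv_atTop_zero.comp h1).const_mul (6 : ℝ)
  refine squeeze_zero (fun m => by positivity) (fun m => ?_) h
  have h2 : ((edgeMax (X m)).card : ℝ) ≤ 6 * ((m : ℝ) ^ 2 + 2) := by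
    have := card_edgeMax_grid_le (hX m)
    rw [card_gridVertex] at this
    exact_mod_cast this
  rw [allEdges_cast, div_le_iff₀ (by positivity)]
  refine h2.trans (le_of_eq ?_)
  field_simp

theorem tendsto_sqrt_allEdges_div :
    Tendsto (fun m => Real.sqrt (allEdges m) / allEdges m) atTop (𝓝 0) := by
  simp_rw [Real.sqrt_div_self']
  simpa [Function.comp_def] using
    tendsto_inv_atTop_zero.comp (Real.tendsto_sqrt_atTop.comp tendsto_allEdges)

theorem one_le_sqrt_allEdges (m : ℕ) : 1 ≤ Real.sqrt (allEdges m) := by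
  rw [Real.one_le_sqrt, allEdges_cast]
  nlinarith [sq_nonneg ((m : ℝ) ^ 2), sq_nonneg (m : ℝ)]

theorem two_le_allEdges (m : ℕ) : (2 : ℝ) ≤ allEdges m := by
  rw [allEdges_cast]
  nlinarith [sq_nonneg ((m : ℝ) ^ 2), sq_nonneg (m : ℝ)]

theorem sqrt_allEdges_lt (m : ℕ) : Real.sqrt (allEdges m) < allEdges m := by
  have h := two_le_allEdges m
  rw [Real.sqrt_lt' (by linarith)]
  nlinarith

theorem sq_add_one_le_sqrt_allEdges (m : ℕ) : (m : ℝ) ^ 2 + 1 ≤ Real.sqrt (allEdges m) := by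
  apply Real.le_sqrt_of_sq_le
  rw [allEdges_cast]
  nlinarith [sq_nonneg (m : ℝ)]

/-! ### Restriction to a subfamily -/

/-- Passing to a subfamily of instances does not make learning harder. -/
theorem LearnsWith.comap {α α' β W : Type} [mα : MeasurableSpace α] [mα' : MeasurableSpace α']
    {h : W → α → β} {h' : W → α' → β} (i : α' → α) (hi : Function.Injective i)
    (hmeas : mα' = mα.comap i) (hcomp : ∀ w x, h' w x = h w (i x)) {A : Learner α β W} {ε δ : ℝ}
    {M : ℕ} (hA : LearnsWith h A ε δ M) :
    LearnsWith h' (fun M S => A M fun j => (i (S j).1, (S j).2)) ε δ M := by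
  classical
  rintro D hD f ⟨w₀, hw₀⟩
  have him : Measurable i := by
    rw [hmeas]
    exact comap_measurable i
  -- Off the range of `i` the labelling is continued by `h w₀`, so the extended problem stays
  -- realizable.
  let f' : α → β := fun y => if hy : ∃ x, i x = y then f hy.choose else h w₀ y
  have hf' : ∀ x, f' (i x) = f x := by
    intro x
    have hy : ∃ x', i x' = i x := ⟨x, rfl⟩
    simp only [f', dif_pos hy]
    exact congrArg f (hi hy.choose_spec)
  have hprob : IsProbabilityMeasure (D.map i) := Measure.isProbabilityMeasure_map him.aemeasurable
  have hae : ∀ᵐ y ∂(D.map i), h w₀ y = f' y := by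
    -- Neither the disagreement set nor the range of `i` need be measurable. Since the sigma-algebra
    -- is the induced one, a measurable null superset is the preimage of a measurable set `N'`,
    -- which is null for the pushforward.
    obtain ⟨N, hN, hNm, hN0⟩ := exists_measurable_superset_of_null (ae_iff.1 hw₀)
    rw [hmeas] at hNm
    obtain ⟨N', hN'm, rfl⟩ := hNm
    rw [ae_iff]
    refine measure_mono_null (t := N') (fun y hy => ?_) ?_
    · by_cases hx : ∃ x, i x = y
      · obtain ⟨x, rfl⟩ := hx
        refine hN (show ¬ h' w₀ x = f x from ?_)
        rw [hcomp, ← hf']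
        exact hy
      · exact absurd (show h w₀ y = f' y by simp only [f', dif_neg hx]) hy
    · rwa [Measure.map_apply him hN'm]
  have hmain := hA (D.map i) hprob f' ⟨w₀, hae⟩
  rw [← Measure.pi_map_pi (fun _ => him.aemeasurable)] at hmain
  have hmap : Measurable fun (S : Fin M → α') j => i (S j) :=
    measurable_pi_lambda _ fun j => him.comp (measurable_pi_apply j)
  -- The failure and error sets may be non-measurable; `Measure.le_map_apply` gives the one
  -- inequality needed for each.
  refine le_trans (measure_mono fun S hS => ?_)
    ((Measure.le_map_apply hmap.aemeasurable _).trans hmain)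
  change ENNReal.ofReal ε < _
  refine lt_of_lt_of_le (show ENNReal.ofReal ε < _ from hS)
    (le_trans (measure_mono fun x hx => ?_) (Measure.le_map_apply him.aemeasurable _))
  change h _ (i x) ≠ f' (i x)
  rw [hf', ← hcomp]
  simp only [hf']
  exact hx

theorem sampleComplexity_le_of_comap {α α' β W : Type} [mα : MeasurableSpace α]
    [mα' : MeasurableSpace α'] {h : W → α → β} {h' : W → α' → β} (i : α' → α)
    (hi : Function.Injective i) (hmeas : mα' = mα.comap i) (hcomp : ∀ w x, h' w x = h w (i x))
    (ε δ : ℝ) : sampleComplexity h' ε δ ≤ sampleComplexity h ε δ := by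
  refine le_iInf₂ fun M₀ hM₀ => iInf₂_le M₀ ?_
  obtain ⟨A, hA⟩ := hM₀
  exact ⟨_, fun M hM => (hA M hM).comap i hi hmeas hcomp⟩

end EdgePAC

open EdgePAC in
theorem theorem2 :
    -- edge counts: linear for grids, quadratic for all graphs on the same `n = m ^ 2 + 2` vertices
    (∀ m : ℕ, 1 ≤ m → ∀ X : Set (Network (GridVertex m)), X ⊆ gridNetworks m →
      Fintype.card (GridVertex m) = m ^ 2 + 2 ∧
      (edgeMax X).card ≤ 6 * Fintype.card (GridVertex m) ∧
      allEdges m = Fintype.card (GridVertex m) * (Fintype.card (GridVertex m) - 1)) ∧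
    -- sample sizes that suffice, with one absolute constant
    (∃ C : ℝ, 0 < C ∧ ∀ m : ℕ, 1 ≤ m → ∀ d : ℕ, 1 ≤ d →
      ∀ tie : Finset (GridVertex m × GridVertex m) → GridVertex m × GridVertex m, IsTieBreak tie →
      (∀ X : Set (Network (GridVertex m)),
        ∀ φ : X → GridVertex m × GridVertex m → Fin d → ℝ, (∀ e, Measurable fun G => φ G e) →
          PACLearnableWith (edgeSelector tie φ)
            (fun ε δ => C * sampleBound (edgeMax X).card d ε δ)) ∧
      (∀ X : Set (Network (GridVertex m)), X ⊆ gridNetworks m →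
        ∀ φ : X → GridVertex m × GridVertex m → Fin d → ℝ, (∀ e, Measurable fun G => φ G e) →
          PACLearnableWith (edgeSelector tie φ)
            (fun ε δ => C * sampleBound (Real.sqrt (allEdges m)) d ε δ))) ∧
    -- the sufficient sample sizes for grids are smaller than the one for all graphs
    (∀ m : ℕ, 1 ≤ m → ∀ X : Set (Network (GridVertex m)), X ⊆ gridNetworks m →
      ∀ d : ℕ, 1 ≤ d → ∀ ε δ : ℝ, 0 < ε → ε < 1 → 0 < δ → δ < 1 →
        sampleBound (edgeMax X).card d ε δ < sampleBound (allEdges m) d ε δ ∧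
        sampleBound (Real.sqrt (allEdges m)) d ε δ < sampleBound (allEdges m) d ε δ) ∧
    -- and of smaller order
    (∀ X : ∀ m : ℕ, Set (Network (GridVertex m)), (∀ m, X m ⊆ gridNetworks m) →
      ∀ d : ℕ, 1 ≤ d → ∀ ε δ : ℝ, 0 < ε → ε < 1 → 0 < δ → δ < 1 →
        Tendsto (fun m => sampleBound (edgeMax (X m)).card d ε δ / sampleBound (allEdges m) d ε δ)
          atTop (𝓝 0) ∧
        Tendsto (fun m => sampleBound (Real.sqrt (allEdges m)) d ε δ /
          sampleBound (allEdges m) d ε δ) atTop (𝓝 0)) ∧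
    -- with the same features, the sample complexity for grids is at most that for all graphs
    (∀ m : ℕ, 1 ≤ m → ∀ X : Set (Network (GridVertex m)), X ⊆ gridNetworks m →
      ∀ d : ℕ, 1 ≤ d →
      ∀ tie : Finset (GridVertex m × GridVertex m) → GridVertex m × GridVertex m, IsTieBreak tie →
      ∀ φ : Network (GridVertex m) → GridVertex m × GridVertex m → Fin d → ℝ,
        (∀ e, Measurable fun G => φ G e) →
        ∀ ε δ : ℝ, 0 < ε → ε < 1 → 0 < δ → δ < 1 →
          sampleComplexity (edgeSelector tie fun (G : X) e => φ G.1 e) ε δ ≤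
            sampleComplexity
              (edgeSelector tie fun (G : (Set.univ : Set (Network (GridVertex m)))) e => φ G.1 e)
              ε δ) := by
  refine ⟨fun m _ X hX => ⟨card_gridVertex m, card_edgeMax_grid_le hX, allEdges_eq m⟩,
    ⟨100, by norm_num, fun m hm d hd tie _ => ⟨fun X φ hφ => ?_, fun X hX φ hφ => ?_⟩⟩,
    fun m _ X hX d hd ε δ hε hε1 _ _ => ⟨?_, ?_⟩,
    fun X hX d hd ε δ hε hε1 hδ hδ1 => ⟨?_, ?_⟩,
    fun m _ X hX d _ tie _ φ _ ε δ _ _ _ _ => ?_⟩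
  · rcases Nat.lt_or_ge 1 (edgeMax X).card with h | h
    · have h2 : (2 : ℝ) ≤ (edgeMax X).card := by exact_mod_cast h
      exact pacLearnableWith_edgeSelector hd tie φ hφ h2 (by linarith)
    · exact pacLearnableWith_of_card_le_one h tie φ _
  · have hm' : (1 : ℝ) ≤ (m : ℝ) ^ 2 := one_le_pow₀ (by exact_mod_cast hm)
    have hs := sq_add_one_le_sqrt_allEdges m
    have hc : ((edgeMax X).card : ℝ) ≤ 6 * ((m : ℝ) ^ 2 + 2) := by
      have := card_edgeMax_grid_le hX
      rw [card_gridVertex] at this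
      exact_mod_cast this
    -- The factor `9` is chosen for this step: `6 * (m ^ 2 + 2) ≤ 9 * (m ^ 2 + 1)` holds exactly
    -- when `m ^ 2 ≥ 1`, and `m ^ 2 + 1 ≤ √(allEdges m)`.
    exact pacLearnableWith_edgeSelector hd tie φ hφ (by linarith) (by linarith)
  · exact sampleBound_lt hd hε hε1 (natCast_eq_zero_or_one_le _)
      (by exact_mod_cast card_edgeMax_grid_lt hX) (two_le_allEdges m)
  · exact sampleBound_lt hd hε hε1 (Or.inr (one_le_sqrt_allEdges m)) (sqrt_allEdges_lt m)
      (two_le_allEdges m)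
  · exact tendsto_sampleBound_div hd hε hε1 hδ hδ1 (fun m => natCast_eq_zero_or_one_le _)
      (fun m => by exact_mod_cast (card_edgeMax_grid_lt (hX m)).le) tendsto_allEdges
      (tendsto_card_edgeMax_div hX)
  · exact tendsto_sampleBound_div hd hε hε1 hδ hδ1 (fun m => Or.inr (one_le_sqrt_allEdges m))
      (fun m => (sqrt_allEdges_lt m).le) tendsto_allEdges tendsto_sqrt_allEdges_div
  · refine sampleComplexity_le_of_comap (fun G : X => ⟨G.1, Set.mem_univ _⟩) ?_ ?_ ?_ ε δ
    · intro G G' h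
      exact Subtype.ext (Subtype.mk.inj h)
    · exact (MeasurableSpace.comap_comp (g := fun G : X => (⟨G.1, Set.mem_univ _⟩ :
        (Set.univ : Set (Network (GridVertex m))))) (f := Subtype.val)).symm
    · exact fun _ _ => rfl
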